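/- Let $D$ be an integral domain with quotient field $K$. An overring of $D$ is a ring $T$ with $D\subseteq T\subseteq K$; the Zariski topology on the set of overrings has the sets $\{T\mid x_1,\dots,x_n\in T\}$ ($x_1,\dots,x_n\in K$) as a subbasis. For an overring $T$ of $D$ put $\sigma(T)=\{Q\cap D\mid Q\in\mathrm{Spec}(T)\}$. A family $\Theta$ of overrings of $D$ is *complete* if $I=\bigcap\{IT\mid T\in\Theta\}$ for every ideal $I$ of $D$ (the empty intersection being $K$), *independent* if $\sigma(A)\cap\sigma(B)=\{(0)\}$ for all $A\neq B$ in $\Theta$, and *locally finite* if every nonzero $x\in K$ is a nonunit in only finitely many members of $\Theta$. Let $\Theta$ be a family of overrings of $D$ with $K\notin\Theta$ or $\Theta=\{K\}$, and suppose that $\Theta$ is complete and independent. Then - $\Theta$ is a *Jaffard family* of $D$ if every $T\in\Theta$ is flat over $D$ and $\Theta$ is locally finite; a *Jaffard overring* of $D$ is a member of some Jaffard family of $D$; - $\Theta$ is a *pre-Jaffard family* of $D$ if every $T\in\Theta$ is flat over $D$ and $\Theta$ is compact in the Zariski topology (every open cover has a finite subcover); - $\Theta$ is a *weak Jaffard family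 of $D$ pointed at $S\in\Theta$* if $S$ is flat over $D$ and every $T\in\Theta\setminus\{S\}$ is a Jaffard overring of $D$. Let $\Theta$ be a pre-Jaffard family of $D$. Define its derived sequence by $T_0:=D$, $\Theta_0:=\Theta$ and, for ordinals $\alpha>0$, $$\Theta_{\alpha}:=\Theta_\gamma\setminus(\Theta_\gamma)_J\ \text{ if }\alpha=\gamma+1,\qquad \Theta_\alpha:=\bigcap_{\beta<\alpha}\Theta_\beta\ \text{ if }\alpha\text{ is a limit ordinal},\qquad T_\alpha:=\bigcap\{S\mid S\in\Theta_\alpha\},$$ where $(\Theta_\gamma)_J$ is the set of those members of $\Theta_\gamma$ that are Jaffard overrings of $T_\gamma$, and $T_\alpha:=K$ if $\Theta_\alpha=\emptyset$. Then, for every ordinal $\alpha$ such that $\Theta_\alpha\neq\emptyset$: (a) $\Theta_\alpha$ is a pre-Jaffard family of $T_\alpha$; (b) if $\alpha=\gamma+1$ is a successor ordinal, then $(\Theta_\gamma)_J\cup\{T_\alpha\}$ is a weak Jaffard family of $T_\gamma$ pointed at $T_\alpha$. -/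

import Mathlib

universe u v

namespace JaffardFamilies

variable {K : Type u} [Field K]

/-! Throughout, the domain `D` is a subring of the field `K`, which in the theorem is its field of
fractions. An overring of `D` is a subring `T` of `K` with `D ≤ T`, and `K` itself, as an overring,
is `⊤ : Subring K`. A family of overrings is a set of subrings, so that the same set can be regarded
as a family of overrings of different base rings. -/

/-- The basic set `B(x₁, …, xₙ)` of the subrings of `K` that contain a given finite set. -/
def basicOpen (F : Finset K) : Set (Subring K) := {T | ∀ x ∈ F, x ∈ T}

/-- The Zariski topology. The Zariski topology on the set of overrings of `D` is the one induced by
this topology on the subset `{T | D ≤ T}`; in particular compactness of a set of overrings of `D`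
does not depend on `D`. -/
abbrev zariskiTopology (K : Type u) [Field K] : TopologicalSpace (Subring K) :=
  TopologicalSpace.generateFrom (Set.range basicOpen)

/-- Compactness (every open cover has a finite subcover) in the Zariski topology. -/
def IsZariskiCompact (Θ : Set (Subring K)) : Prop :=
  @IsCompact (Subring K) (zariskiTopology K) Θ

/-- `T` is an overring of `D` that is flat as a `D`-module. -/
def IsFlatOverring (D T : Subring K) : Prop :=
  ∃ h : D ≤ T, (Subring.inclusion h).Flat

/-- `σ(T)`: the set of the primes `Q ∩ D` of `D`, where `Q` is a prime of the overring `T`. -/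
def contractedPrimes {D T : Subring K} (h : D ≤ T) : Set (PrimeSpectrum D) :=
  Set.range (PrimeSpectrum.comap (Subring.inclusion h))

/-- The extension `I T` inside `K` of an ideal `I` of `D` to an overring `T` of `D`: the
`T`-submodule of `K` generated by `I`. -/
def extension {D : Subring K} (I : Ideal D) (T : Subring K) : Submodule T K :=
  Submodule.span T ((fun x : D => (x : K)) '' (I : Set D))

/-- `Θ` is complete: `I = ⋂ {I T | T ∈ Θ}` for every ideal `I` of `D`. The intersection takes
place in `K`, so that it is `K` for the empty family. -/
def IsCompleteFamily (D : Subring K) (Θ : Set (Subring K)) : Prop :=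
  ∀ I : Ideal D, (fun x : D => (x : K)) '' (I : Set D) = ⋂ T ∈ Θ, (extension I T : Set K)

/-- `Θ` is independent: `σ(A) ∩ σ(B) = {(0)}` for all distinct members `A`, `B`. -/
def IsIndependentFamily (D : Subring K) (Θ : Set (Subring K)) : Prop :=
  ∀ A ∈ Θ, ∀ B ∈ Θ, A ≠ B → ∀ (hA : D ≤ A) (hB : D ≤ B), contractedPrimes hA ∩ contractedPrimes hB = {⊥}

/-- `Θ` is locally finite: every nonzero `x` in `K` is a nonunit in only finitely many members. -/
def IsLocallyFiniteFamily (Θ : Set (Subring K)) : Prop :=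
  ∀ x : K, x ≠ 0 → {T ∈ Θ | ∃ h : x ∈ T, ¬ IsUnit (⟨x, h⟩ : T)}.Finite

/-- Jaffard families of `D`. -/
structure IsJaffardFamily (D : Subring K) (Θ : Set (Subring K)) : Prop where
  overring : ∀ T ∈ Θ, D ≤ T
  top_notMem_or : ⊤ ∉ Θ ∨ Θ = {⊤}
  flat : ∀ T ∈ Θ, IsFlatOverring D T
  complete : IsCompleteFamily D Θ
  independent : IsIndependentFamily D Θ
  locallyFinite : IsLocallyFiniteFamily Θ

/-- A Jaffard overring of `D` is a member of some Jaffard family of `D`. -/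
def IsJaffardOverring (D T : Subring K) : Prop :=
  ∃ Θ : Set (Subring K), IsJaffardFamily D Θ ∧ T ∈ Θ

/-- Pre-Jaffard families of `D`. -/
structure IsPreJaffardFamily (D : Subring K) (Θ : Set (Subring K)) : Prop where
  overring : ∀ T ∈ Θ, D ≤ T
  top_notMem_or : ⊤ ∉ Θ ∨ Θ = {⊤}
  flat : ∀ T ∈ Θ, IsFlatOverring D T
  independent : IsIndependentFamily D Θ
  complete : IsCompleteFamily D Θ
  compact : IsZariskiCompact Θ

/-- Weak Jaffard families of `D` pointed at `S`. -/
structure IsWeakJaffardFamily (D : Subring K) (Θ : Set (Subring K)) (S : Subring K) : Prop where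
  overring : ∀ T ∈ Θ, D ≤ T
  mem : S ∈ Θ
  top_notMem_or : ⊤ ∉ Θ ∨ Θ = {⊤}
  complete : IsCompleteFamily D Θ
  independent : IsIndependentFamily D Θ
  jaffard : ∀ T ∈ Θ \ {S}, IsJaffardOverring D T
  flat : IsFlatOverring D S

/-- `Θ_J`: the set of the members of `Θ` that are Jaffard overrings of `D`. -/
def jaffardPart (D : Subring K) (Θ : Set (Subring K)) : Set (Subring K) :=
  {T ∈ Θ | IsJaffardOverring D T}

/-- The pairs `(T_α, Θ_α)`, by transfinite recursion. Here `sInf` is the intersection of subrings;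
it is `⊤`, that is `K`, for the empty set. -/
noncomputable def derivedPair (D : Subring K) (Θ : Set (Subring K)) (α : Ordinal.{v}) :
    Subring K × Set (Subring K) :=
  Ordinal.limitRecOn α (D, Θ)
    (fun _ p => (sInf (p.2 \ jaffardPart p.1 p.2), p.2 \ jaffardPart p.1 p.2))
    (fun α _ p => (sInf (⋂ (β) (h : β < α), (p β h).2), ⋂ (β) (h : β < α), (p β h).2))

/-- The ring `T_α` of the derived sequence of `Θ`. -/
noncomputable def derivedRing (D : Subring K) (Θ : Set (Subring K)) (α : Ordinal.{v}) :
    Subring K :=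
  (derivedPair D Θ α).1

/-- The subfamily `Θ_α` of `Θ` that belongs to `T_α`. -/
noncomputable def derivedFamily (D : Subring K) (Θ : Set (Subring K)) (α : Ordinal.{v}) :
    Set (Subring K) :=
  (derivedPair D Θ α).2

theorem derivedRing_zero (D : Subring K) (Θ : Set (Subring K)) :
    derivedRing D Θ (0 : Ordinal.{v}) = D := by
  simp [derivedRing, derivedPair]

theorem derivedFamily_zero (D : Subring K) (Θ : Set (Subring K)) :
    derivedFamily D Θ (0 : Ordinal.{v}) = Θ := by
  simp [derivedFamily, derivedPair]

theorem derivedFamily_add_one (D : Subring K) (Θ : Set (Subring K)) (γ : Ordinal.{v}) :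
    derivedFamily D Θ (γ + 1) =
      derivedFamily D Θ γ \ jaffardPart (derivedRing D Θ γ) (derivedFamily D Θ γ) := by
  simp [derivedFamily, derivedRing, derivedPair]

theorem derivedFamily_limit (D : Subring K) (Θ : Set (Subring K)) {α : Ordinal.{v}}
    (hα : Order.IsSuccLimit α) :
    derivedFamily D Θ α = ⋂ β < α, derivedFamily D Θ β := by
  simp [derivedFamily, derivedPair, Ordinal.limitRecOn_limit _ _ _ _ hα]

theorem derivedRing_of_ne_zero (D : Subring K) (Θ : Set (Subring K)) {α : Ordinal.{v}}
    (hα : α ≠ 0) : derivedRing D Θ α = sInf (derivedFamily D Θ α) := by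
  induction α using Ordinal.limitRecOn with
  | zero => exact absurd rfl hα
  | add_one γ _ => simp [derivedFamily, derivedRing, derivedPair]
  | limit α h _ =>
    simp [derivedFamily, derivedRing, derivedPair, Ordinal.limitRecOn_limit _ _ _ _ h]

end JaffardFamilies

open JaffardFamilies

/-!
A flat overring `T` of `D` is controlled by the ideals `J` of `D` with `J T = T`: the compositum of
`T` with another overring `A` consists of the `x` in `K` such that `J x ⊆ A` for one such `J`, and
it is `K` as soon as `σ(A) ∩ σ(T) = {(0)}`. Both conditions on `J` are witnessed by finitely many
elements of `K`, so for a Zariski compact set of overrings the compositum with `T` commutes with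
intersection. Hence the intersection `S` of a compact subfamily of a pre-Jaffard family has
compositum `K` with every member outside the subfamily. Then every nonzero prime in `σ(S)` comes
from a member of the subfamily, which makes `S` flat and the subfamily a pre-Jaffard family of `S`.

It remains to see that the derived families are compact. If `T` is a Jaffard member, its compositum
with the intersection of the other members is `K`, so for nonzero `a` in `D` some Zariski
neighbourhood of `T` contains no other member in which `a` is a nonunit. Removing the Jaffard
members therefore leaves a set that is closed on the locus where `a` is a nonunit. This property
passes to intersections, hence to limit stages, and it implies compactness, because every
neighbourhood of a member contains all members in which a suitable `a` is a unit.
-/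

namespace JaffardFamilies

variable {K : Type u} [Field K] {D R S T A : Subring K}

/-! ### Denominators -/

theorem exists_mul_mem (D : Subring K) [IsFractionRing D K] (x : K) :
    ∃ b : D, b ≠ 0 ∧ (b : K) * x ∈ D := by
  obtain ⟨a, b, hb, rfl⟩ := IsFractionRing.div_surjective D x
  have hb0 : b ≠ 0 := nonZeroDivisors.ne_zero hb
  refine ⟨b, hb0, ?_⟩
  change (b : K) * ((a : K) / b) ∈ D
  rw [mul_div_cancel₀ _ (ZeroMemClass.coe_eq_zero.not.mpr hb0)]
  exact a.2

theorem isFractionRing_of_le [IsFractionRing D K] (h : D ≤ R) : IsFractionRing R K := by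
  refine IsFractionRing.of_field R K fun z => ?_
  obtain ⟨a, b, -, rfl⟩ := IsFractionRing.div_surjective D z
  exact ⟨Subring.inclusion h a, Subring.inclusion h b, rfl⟩

theorem mem_of_inv_mem {b : D} (hb : b ≠ 0) {x : K} (hbx : (b : K) * x ∈ D) (h : D ≤ A)
    (hbA : (b : K)⁻¹ ∈ A) : x ∈ A := by
  rw [← inv_mul_cancel_left₀ (ZeroMemClass.coe_eq_zero.not.mpr hb) x]
  exact mul_mem hbA (h hbx)

/-! ### Extensions of ideals and contracted primes -/

theorem coe_mem_extension {I : Ideal D} {d : D} (hd : d ∈ I) (T : Subring K) :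
    (d : K) ∈ extension I T :=
  Submodule.subset_span ⟨d, hd, rfl⟩

theorem one_mem_extension_top (T : Subring K) : (1 : K) ∈ extension (⊤ : Ideal D) T :=
  coe_mem_extension (d := 1) Submodule.mem_top T

theorem extension_subset_of_le (I : Ideal D) (h : S ≤ T) :
    (extension I S : Set K) ⊆ extension I T := by
  intro x hx
  induction hx using Submodule.span_induction with
  | mem x hx => exact Submodule.subset_span hx
  | zero => exact zero_mem _
  | add x y _ _ hx hy => exact add_mem hx hy
  | smul s x _ hx => exact (extension I T).smul_mem (Subring.inclusion h s) hx

theorem one_mem_extension_mul {I J : Ideal D} (hI : (1 : K) ∈ extension I T)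
    (hJ : (1 : K) ∈ extension J T) : (1 : K) ∈ extension (I * J) T := by
  have h1 : (1 : K) * 1 ∈ extension I T * extension J T := Submodule.mul_mem_mul hI hJ
  rw [mul_one, extension, extension, Submodule.span_mul_span] at h1
  refine Submodule.span_mono ?_ h1
  rintro _ ⟨_, ⟨c, hc, rfl⟩, _, ⟨d, hd, rfl⟩, rfl⟩
  exact ⟨c * d, Ideal.mul_mem_mul hc hd, rfl⟩

theorem one_mem_extension_iff_map_eq_top (h : D ≤ T) {J : Ideal D} :
    (1 : K) ∈ extension J T ↔ J.map (Subring.inclusion h) = ⊤ := by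
  have hmap : extension J T =
      Submodule.map (Algebra.linearMap T K) (J.map (Subring.inclusion h)) := by
    rw [extension, Ideal.map, Ideal.span, Submodule.map_span, Set.image_image]
    rfl
  rw [hmap, Ideal.eq_top_iff_one]
  constructor
  · rintro ⟨y, hy, hy1⟩
    rwa [← show y = 1 from Subtype.ext hy1]
  · exact fun h1 => ⟨1, h1, rfl⟩

theorem one_mem_extension_iff_forall_prime (h : D ≤ T) {J : Ideal D} :
    (1 : K) ∈ extension J T ↔ ∀ P ∈ contractedPrimes h, ¬ J ≤ P.asIdeal := by
  rw [one_mem_extension_iff_map_eq_top h]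
  constructor
  · rintro hJ _ ⟨Q, rfl⟩ hle
    exact Q.2.ne_top (top_le_iff.mp (hJ ▸ Ideal.map_le_iff_le_comap.mpr hle))
  · intro hJ
    by_contra hne
    obtain ⟨M, hM, hle⟩ := Ideal.exists_le_maximal _ hne
    exact hJ _ ⟨⟨M, hM.isPrime⟩, rfl⟩ (Ideal.map_le_iff_le_comap.mp hle)

theorem bot_mem_contractedPrimes (h : D ≤ T) : ⊥ ∈ contractedPrimes h :=
  ⟨⊥, PrimeSpectrum.ext (Ideal.comap_bot_of_injective _ (Subring.inclusion_injective h))⟩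

theorem contractedPrimes_inter_eq_bot_iff (hA : D ≤ A) (hT : D ≤ T) :
    contractedPrimes hA ∩ contractedPrimes hT = {⊥} ↔
      ∀ P ∈ contractedPrimes hA, P ∈ contractedPrimes hT → P = ⊥ := by
  refine ⟨fun h P hPA hPT => h.subset ⟨hPA, hPT⟩, fun h => subset_antisymm
    (fun P hP => h P hP.1 hP.2) (Set.singleton_subset_iff.mpr ?_)⟩
  exact ⟨bot_mem_contractedPrimes hA, bot_mem_contractedPrimes hT⟩

theorem comap_mem_contractedPrimes (hDR : D ≤ R) (hRT : R ≤ T) {Q : PrimeSpectrum R}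
    (hQ : Q ∈ contractedPrimes hRT) :
    PrimeSpectrum.comap (Subring.inclusion hDR) Q ∈ contractedPrimes (hDR.trans hRT) := by
  obtain ⟨Q', rfl⟩ := hQ
  exact ⟨Q', rfl⟩

theorem eq_bot_of_comap_eq_bot [IsFractionRing D K] (h : D ≤ R) {Q : PrimeSpectrum R}
    (hQ : PrimeSpectrum.comap (Subring.inclusion h) Q = ⊥) : Q = ⊥ := by
  refine PrimeSpectrum.ext (le_antisymm (fun x hx => ?_) bot_le)
  obtain ⟨b, hb, hbx⟩ := exists_mul_mem D (x : K)
  have hmem : ⟨_, hbx⟩ ∈ (PrimeSpectrum.comap (Subring.inclusion h) Q).asIdeal :=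
    Q.asIdeal.mul_mem_left (Subring.inclusion h b) hx
  rw [hQ] at hmem
  have hbx0 : (b : K) * x = 0 := congrArg Subtype.val (show (⟨_, hbx⟩ : D) = 0 from hmem)
  exact Subtype.ext ((mul_eq_zero.mp hbx0).resolve_left (ZeroMemClass.coe_eq_zero.not.mpr hb))

theorem IsFlatOverring.mem_contractedPrimes_of_le (hT : IsFlatOverring D T)
    {P P' : PrimeSpectrum D} (hP : P ∈ contractedPrimes hT.1) (hle : P' ≤ P) :
    P' ∈ contractedPrimes hT.1 := by
  obtain ⟨Q, rfl⟩ := hP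
  obtain ⟨Q', -, hQ'⟩ :=
    hT.2.generalizingMap_comap ((PrimeSpectrum.le_iff_specializes _ _).mp hle)
  exact ⟨Q', hQ'⟩

theorem IsFlatOverring.mem_contractedPrimes_iff (hT : IsFlatOverring D T)
    {P : PrimeSpectrum D} :
    P ∈ contractedPrimes hT.1 ↔ (1 : K) ∉ extension P.asIdeal T := by
  rw [one_mem_extension_iff_forall_prime hT.1]
  push Not
  exact ⟨fun hP => ⟨P, hP, le_rfl⟩, fun ⟨_, hP', hle⟩ => hT.mem_contractedPrimes_of_le hP' hle⟩

/-! ### Saturation -/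

/-- The elements of `K` that some ideal `J` of `D` with `J T = T` multiplies into `X`. For a flat
overring `T` and a `D`-submodule `X` of `K`, this is the `T`-module generated by `X`. -/
def saturation (D T : Subring K) (X : Set K) : Set K :=
  {x | ∃ J : Ideal D, (1 : K) ∈ extension J T ∧ ∀ d ∈ J, (d : K) * x ∈ X}

theorem mem_saturation_of_forall_mul_mem (T : Subring K) {X : Set K} {x : K}
    (hx : ∀ d : D, (d : K) * x ∈ X) : x ∈ saturation D T X :=
  ⟨⊤, one_mem_extension_top T, fun d _ => hx d⟩

theorem saturation_mono {X Y : Set K} (h : X ⊆ Y) : saturation D T X ⊆ saturation D T Y :=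
  fun _ ⟨J, hJ, hJx⟩ => ⟨J, hJ, fun d hd => h (hJx d hd)⟩

theorem exists_common_ideal_of_mem_saturation {X : Set K} {ι : Type*} (s : Finset ι) {x : ι → K}
    (hx : ∀ i ∈ s, x i ∈ saturation D T X) :
    ∃ J : Ideal D, (1 : K) ∈ extension J T ∧ ∀ d ∈ J, ∀ i ∈ s, (d : K) * x i ∈ X := by
  classical
  induction s using Finset.induction_on with
  | empty => exact ⟨⊤, one_mem_extension_top T, by simp⟩
  | insert j s _ ih =>
    rw [Finset.forall_mem_insert] at hx
    obtain ⟨I, hI, hIx⟩ := hx.1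
    obtain ⟨J, hJ, hJx⟩ := ih hx.2
    refine ⟨I * J, one_mem_extension_mul hI hJ, fun d hd => ?_⟩
    have hd' : d ∈ I ⊓ J := Ideal.mul_le_inf hd
    exact Finset.forall_mem_insert .. |>.mpr ⟨hIx d hd'.1, hJx d hd'.2⟩

theorem saturation_inter (X Y : Set K) :
    saturation D T (X ∩ Y) = saturation D T X ∩ saturation D T Y := by
  refine subset_antisymm (Set.subset_inter (saturation_mono Set.inter_subset_left)
    (saturation_mono Set.inter_subset_right)) ?_
  rintro x ⟨⟨I, hI, hIx⟩, ⟨J, hJ, hJx⟩⟩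
  refine ⟨I * J, one_mem_extension_mul hI hJ, fun d hd => ?_⟩
  have hd' : d ∈ I ⊓ J := Ideal.mul_le_inf hd
  exact ⟨hIx d hd'.1, hJx d hd'.2⟩

theorem saturation_subset_of_le (h : T ≤ A) : saturation D T (A : Set K) ⊆ A := by
  rintro x ⟨J, hJ, hJx⟩
  suffices ∀ y ∈ extension J T, y * x ∈ A by
    rw [← one_mul x]
    exact this 1 hJ
  intro y hy
  induction hy using Submodule.span_induction with
  | mem y hy =>
    obtain ⟨d, hd, rfl⟩ := hy
    exact hJx d hd
  | zero => simp only [zero_mul, zero_mem]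
  | add y z _ _ hy hz =>
    rw [add_mul]
    exact add_mem hy hz
  | smul t y _ hy =>
    rw [Subring.smul_def, smul_eq_mul, mul_assoc]
    exact mul_mem (h t.2) hy

/-- An overring `A` of `D`, regarded as a `D`-submodule of `K`, so that the elements of `D` that
multiply a given `x` into `A` form the ideal `(overringSubmodule h).colon {x}`. -/
def overringSubmodule (h : D ≤ A) : Submodule D K :=
  { A.toAddSubgroup with smul_mem' := fun d _ hx => A.mul_mem (h d.2) hx }

theorem mem_saturation_iff_forall_prime (h : D ≤ T) (M : Submodule D K) {x : K} :
    x ∈ saturation D T M ↔ ∀ P ∈ contractedPrimes h, ∃ d ∉ P.asIdeal, (d : K) * x ∈ M := by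
  constructor
  · rintro ⟨J, hJ, hJx⟩ P hP
    obtain ⟨d, hd, hdP⟩ := SetLike.not_le_iff_exists.mp
      ((one_mem_extension_iff_forall_prime h).mp hJ P hP)
    exact ⟨d, hdP, hJx d hd⟩
  · intro hx
    refine ⟨M.colon {x}, (one_mem_extension_iff_forall_prime h).mpr fun P hP hle => ?_,
      fun d hd => Submodule.mem_colon_singleton.mp hd⟩
    obtain ⟨d, hd, hdx⟩ := hx P hP
    exact hd (hle (Submodule.mem_colon_singleton.mpr hdx))

/-! ### Flat overrings -/

theorem exists_sum_smul_eq_one_of_flat {R S : Type*} [CommRing R] [CommRing S] [Algebra R S]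
    [Module.Flat R S] {a b : R} {t : S} (h : a • (1 : S) = b • t) :
    ∃ (n : ℕ) (c c' : Fin n → R) (y : Fin n → S), ∑ j, c j • y j = 1 ∧
      ∀ j, a * c j = b * c' j := by
  have hrel : ∑ i, (![a, -b] : Fin 2 → R) i • (![1, t] : Fin 2 → S) i = 0 := by
    simp [Fin.sum_univ_two, h]
  obtain ⟨n, c, y, hcy, hc⟩ :=
    Module.Flat.isTrivialRelation_of_sum_smul_eq_zero (R := R) (M := S) hrel
  refine ⟨n, c 0, c 1, y, (hcy 0).symm, fun j => ?_⟩
  have hj := hc j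
  simp only [Fin.sum_univ_two, Matrix.cons_val_zero, Matrix.cons_val_one] at hj
  linear_combination hj

theorem flat_of_exists_sum_smul_eq_one {R S : Type*} [CommRing R] [CommRing S] [Algebra R S]
    [FaithfulSMul R S]
    (h : ∀ (l : ℕ) (x : Fin l → S), ∃ (n : ℕ) (e : Fin n → R) (c : Fin n → S),
      ∑ j, e j • c j = 1 ∧ ∀ i j, ∃ r : R, algebraMap R S r = e j • x i) :
    Module.Flat R S := by
  refine Module.Flat.of_forall_isTrivialRelation fun {l f x} hfx => ?_
  obtain ⟨n, e, c, hec, hr⟩ := h l x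
  choose r hr using hr
  refine ⟨n, r, c, fun i => ?_, fun j => FaithfulSMul.algebraMap_injective R S ?_⟩
  · calc x i = (∑ j, e j • c j) * x i := by rw [hec, one_mul]
      _ = ∑ j, r i j • c j := by
        rw [Finset.sum_mul]
        refine Finset.sum_congr rfl fun j _ => ?_
        rw [Algebra.smul_def (r i j), hr, smul_mul_assoc, smul_mul_assoc, mul_comm]
  · calc algebraMap R S (∑ i, f i * r i j) = e j • ∑ i, f i • x i := by
          rw [map_sum, Finset.smul_sum]
          refine Finset.sum_congr rfl fun i _ => ?_
          rw [map_mul, hr, ← Algebra.smul_def, smul_comm]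
      _ = algebraMap R S 0 := by rw [hfx, smul_zero, map_zero]

theorem IsFlatOverring.subset_saturation [IsFractionRing D K] (hT : IsFlatOverring D T) :
    (T : Set K) ⊆ saturation D T D := by
  intro t ht
  obtain ⟨h, hflat⟩ := hT
  let _ : Algebra D T := (Subring.inclusion h).toAlgebra
  have : Module.Flat D T := hflat
  obtain ⟨b, hb, hbt⟩ := exists_mul_mem D t
  have hrel : (⟨_, hbt⟩ : D) • (1 : T) = b • (⟨t, ht⟩ : T) := Subtype.ext (mul_one _)
  obtain ⟨n, c, c', y, hcy, hc⟩ := exists_sum_smul_eq_one_of_flat hrel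
  have hct : ∀ j, (c j : K) * t = c' j := fun j => by
    have hj : (b : K) * t * c j = b * c' j := congrArg Subtype.val (hc j)
    apply mul_left_cancel₀ (ZeroMemClass.coe_eq_zero.not.mpr hb)
    linear_combination hj
  refine ⟨(overringSubmodule le_rfl).colon {t}, ?_,
    fun d hd => Submodule.mem_colon_singleton.mp hd⟩
  rw [one_mem_extension_iff_map_eq_top h, Ideal.eq_top_iff_one, ← hcy]
  refine sum_mem fun j _ => Ideal.mul_mem_right _ _ (Ideal.mem_map_of_mem _ ?_)
  refine Submodule.mem_colon_singleton.mpr ?_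
  change (c j : K) * t ∈ D
  exact hct j ▸ (c' j).2

theorem isFlatOverring_of_subset_saturation (h : D ≤ T) (hT : (T : Set K) ⊆ saturation D T D) :
    IsFlatOverring D T := by
  refine ⟨h, ?_⟩
  let _ : Algebra D T := (Subring.inclusion h).toAlgebra
  have : FaithfulSMul D T :=
    (faithfulSMul_iff_algebraMap_injective D T).mpr (Subring.inclusion_injective h)
  refine flat_of_exists_sum_smul_eq_one fun l x => ?_
  obtain ⟨J, hJ, hJx⟩ := exists_common_ideal_of_mem_saturation Finset.univ
    (x := fun i => (x i : K)) fun i _ => hT (x i).2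
  have h1 : (1 : T) ∈ J.map (Subring.inclusion h) :=
    (one_mem_extension_iff_map_eq_top h).mp hJ ▸ Submodule.mem_top
  obtain ⟨n, c, g, hg⟩ := Submodule.mem_span_set'.mp h1
  choose e he heg using fun j => (g j).2
  refine ⟨n, e, c, ?_, fun i j => ⟨⟨_, hJx (e j) (he j) i (Finset.mem_univ i)⟩, rfl⟩⟩
  rw [← hg]
  refine Finset.sum_congr rfl fun j _ => ?_
  rw [← heg j, Algebra.smul_def, mul_comm]
  rfl

theorem saturation_subset_saturation_of_le (h : D ≤ R) :
    saturation D T (D : Set K) ⊆ saturation R T R := by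
  rintro x ⟨J, hJ, hJx⟩
  refine ⟨(overringSubmodule le_rfl).colon {x}, Submodule.span_mono ?_ hJ,
    fun d hd => Submodule.mem_colon_singleton.mp hd⟩
  rintro _ ⟨d, hd, rfl⟩
  exact ⟨Subring.inclusion h d, Submodule.mem_colon_singleton.mpr (h (hJx d hd)), rfl⟩

theorem IsFlatOverring.of_le [IsFractionRing D K] (hT : IsFlatOverring D T) (hDR : D ≤ R)
    (hRT : R ≤ T) : IsFlatOverring R T :=
  isFlatOverring_of_subset_saturation hRT
    (hT.subset_saturation.trans (saturation_subset_saturation_of_le hDR))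

theorem IsFlatOverring.extension_subset_saturation [IsFractionRing D K]
    (hT : IsFlatOverring D T) (hDR : D ≤ R) (I : Ideal R) :
    (extension I T : Set K) ⊆ saturation D T ((fun x : R => (x : K)) '' (I : Set R)) := by
  intro x hx
  induction hx using Submodule.span_induction with
  | mem x hx =>
    obtain ⟨i, hi, rfl⟩ := hx
    exact mem_saturation_of_forall_mul_mem T fun d =>
      ⟨Subring.inclusion hDR d * i, I.mul_mem_left _ hi, rfl⟩
  | zero => exact mem_saturation_of_forall_mul_mem T fun d => ⟨0, I.zero_mem, (mul_zero _).symm⟩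
  | add x y _ _ hx hy =>
    obtain ⟨J, hJ, hJx⟩ := hx
    obtain ⟨J', hJ', hJy⟩ := hy
    refine ⟨J * J', one_mem_extension_mul hJ hJ', fun d hd => ?_⟩
    have hd' : d ∈ J ⊓ J' := Ideal.mul_le_inf hd
    obtain ⟨i, hi, hix⟩ := hJx d hd'.1
    obtain ⟨j, hj, hjy⟩ := hJy d hd'.2
    exact ⟨i + j, I.add_mem hi hj, by simp only [Subring.coe_add, hix, hjy, mul_add]⟩
  | smul t y _ hy =>
    obtain ⟨J, hJ, hJt⟩ := hT.subset_saturation t.2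
    obtain ⟨J', hJ', hJy⟩ := hy
    refine ⟨J * J', one_mem_extension_mul hJ hJ', fun d hd => ?_⟩
    induction hd using Submodule.mul_induction_on' with
    | mem_mul_mem e he f hf =>
      obtain ⟨i, hi, hiy⟩ := hJy f hf
      refine ⟨⟨_, hDR (hJt e he)⟩ * i, I.mul_mem_left _ hi, ?_⟩
      change (e : K) * t * i = (e * f : K) * (t * y)
      rw [show (i : K) = f * y from hiy]
      ring
    | add c _ d _ hc hd =>
      obtain ⟨i, hi, hic⟩ := hc
      obtain ⟨j, hj, hjd⟩ := hd
      exact ⟨i + j, I.add_mem hi hj, by simp only [Subring.coe_add, hic, hjd, add_mul]⟩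

theorem IsFlatOverring.mem_contractedPrimes_of_comap [IsFractionRing D K]
    (hT : IsFlatOverring D T) (hDR : D ≤ R) (hRT : R ≤ T) {Q : PrimeSpectrum R}
    (hQ : PrimeSpectrum.comap (Subring.inclusion hDR) Q ∈ contractedPrimes hT.1) :
    Q ∈ contractedPrimes hRT := by
  refine (hT.of_le hDR hRT).mem_contractedPrimes_iff.mpr fun h1 => ?_
  obtain ⟨J, hJ, hJQ⟩ := hT.extension_subset_saturation hDR Q.asIdeal h1
  refine (one_mem_extension_iff_forall_prime hT.1).mp hJ _ hQ fun d hd => ?_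
  obtain ⟨q, hq, hqd⟩ := hJQ d hd
  rwa [show q = Subring.inclusion hDR d from Subtype.ext (hqd.trans (mul_one _))] at hq

/-! ### Overrings whose compositum is the quotient field -/

theorem contractedPrimes_inter_eq_bot_of_saturation_eq_univ (hA : D ≤ A) (hT : D ≤ T)
    (h : saturation D T (A : Set K) = Set.univ) :
    contractedPrimes hA ∩ contractedPrimes hT = {⊥} := by
  rw [contractedPrimes_inter_eq_bot_iff]
  rintro _ ⟨Q, rfl⟩ hQT
  refine PrimeSpectrum.ext (le_antisymm (fun a ha => ?_) bot_le)
  by_contra ha0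
  obtain ⟨d, hd, hda⟩ := (mem_saturation_iff_forall_prime hT (overringSubmodule hA)).mp
    (h.ge (Set.mem_univ (a : K)⁻¹)) _ hQT
  refine hd ?_
  have hmul : Subring.inclusion hA d = ⟨_, hda⟩ * Subring.inclusion hA a :=
    Subtype.ext (inv_mul_cancel_right₀ (ZeroMemClass.coe_eq_zero.not.mpr ha0) (d : K)).symm
  change Subring.inclusion hA d ∈ Q.asIdeal
  rw [hmul]
  exact Q.asIdeal.mul_mem_left _ ha

theorem IsFlatOverring.saturation_eq_univ [IsFractionRing D K] (hT : IsFlatOverring D T)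
    (hA : D ≤ A) (h : contractedPrimes hA ∩ contractedPrimes hT.1 = {⊥}) :
    saturation D T (A : Set K) = Set.univ := by
  refine Set.eq_univ_of_forall fun x => ?_
  refine (mem_saturation_iff_forall_prime hT.1 (overringSubmodule hA)).mpr fun P hP => ?_
  by_contra! hPx
  let C : Ideal A := (overringSubmodule le_rfl).colon {x}
  have hCP : C.comap (Subring.inclusion hA) ≤ P.asIdeal := fun d hd => by
    by_contra hdP
    exact hPx d hdP (Submodule.mem_colon_singleton.mp hd)
  obtain ⟨Q, hCQ, hQ, hQP⟩ := Ideal.exists_ideal_comap_le_prime P.asIdeal C hCP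
  have hbot := (contractedPrimes_inter_eq_bot_iff hA hT.1).mp h _ ⟨⟨Q, hQ⟩, rfl⟩
    (hT.mem_contractedPrimes_of_le hP hQP)
  obtain ⟨b, hb, hbx⟩ := exists_mul_mem D x
  have hbQ : b ∈ (PrimeSpectrum.comap (Subring.inclusion hA) ⟨Q, hQ⟩).asIdeal :=
    hCQ (Submodule.mem_colon_singleton.mpr (hA hbx))
  rw [hbot] at hbQ
  exact hb hbQ

/-! ### The Zariski topology -/

attribute [local instance] zariskiTopology

theorem isTopologicalBasis_range_basicOpen :
    TopologicalSpace.IsTopologicalBasis (Set.range (basicOpen (K := K))) where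
  exists_subset_inter := by
    classical
    rintro _ ⟨F, rfl⟩ _ ⟨G, rfl⟩ A ⟨hF, hG⟩
    refine ⟨_, ⟨F ∪ G, rfl⟩, fun x hx => ?_, fun B hB => ⟨fun x hx => ?_, fun x hx => ?_⟩⟩
    · exact (Finset.mem_union.mp hx).elim (hF x) (hG x)
    · exact hB x (Finset.mem_union_left G hx)
    · exact hB x (Finset.mem_union_right F hx)
  sUnion_eq := Set.eq_univ_of_forall fun _ => ⟨_, ⟨∅, rfl⟩, by simp [basicOpen]⟩
  eq_generateFrom := rfl

theorem isOpen_basicOpen (F : Finset K) : IsOpen (basicOpen F) :=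
  isTopologicalBasis_range_basicOpen.isOpen ⟨F, rfl⟩

theorem isClosed_setOf_notMem (x : K) : IsClosed {A : Subring K | x ∉ A} := by
  have h : {A : Subring K | x ∉ A} = (basicOpen {x})ᶜ := by ext; simp [basicOpen]
  rw [h]
  exact (isOpen_basicOpen _).isClosed_compl

theorem isZariskiCompact_of_forall_inv_notMem [IsFractionRing D K] {Θ : Set (Subring K)}
    (hD : ∀ A ∈ Θ, D ≤ A)
    (hΘ : ∀ a : D, a ≠ 0 → IsZariskiCompact (Θ ∩ {A | (a : K)⁻¹ ∉ A})) :
    IsZariskiCompact Θ := by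
  classical
  refine isCompact_of_finite_subcover fun U hU hcover => ?_
  rcases Θ.eq_empty_or_nonempty with rfl | ⟨A, hA⟩
  · exact ⟨∅, Set.empty_subset _⟩
  obtain ⟨i, hi⟩ := Set.mem_iUnion.mp (hcover hA)
  obtain ⟨_, ⟨F, rfl⟩, -, hF⟩ := isTopologicalBasis_range_basicOpen.exists_subset_of_mem_open
    hi (hU i)
  obtain ⟨b, hb⟩ := IsLocalization.exist_integer_multiples_of_finset (nonZeroDivisors D) F
  have hb0 : (b : D) ≠ 0 := nonZeroDivisors.ne_zero b.2
  obtain ⟨t, ht⟩ := (hΘ b hb0).elim_finite_subcover U hU (Set.inter_subset_left.trans hcover)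
  refine ⟨insert i t, fun B hB => ?_⟩
  rw [Finset.set_biUnion_insert]
  by_cases hbB : ((b : D) : K)⁻¹ ∈ B
  · refine Or.inl (hF fun x hx => ?_)
    have hbx : ((b : D) : K) * x ∈ D := by
      obtain ⟨d, hd⟩ := hb x hx
      exact hd.subst d.2
    exact mem_of_inv_mem hb0 hbx (hD B hB) hbB
  · exact Or.inr (ht ⟨hB, hbB⟩)

theorem exists_basicOpen_of_mem_saturation {x : K} (hx : x ∈ saturation D T (A : Set K)) :
    ∃ F : Finset K, A ∈ basicOpen F ∧ ∀ Λ ⊆ basicOpen F, (∀ B ∈ Λ, D ≤ B) →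
      x ∈ saturation D T (sInf Λ : Subring K) := by
  classical
  obtain ⟨J, hJ, hJx⟩ := hx
  obtain ⟨G, hG, hG1⟩ := Submodule.mem_span_finite_of_mem_span hJ
  refine ⟨G.image (· * x), fun y hy => ?_, fun Λ hΛ hDΛ => ?_⟩
  · obtain ⟨g, hg, rfl⟩ := Finset.mem_image.mp hy
    obtain ⟨d, hd, rfl⟩ := hG hg
    exact hJx d hd
  · refine ⟨(overringSubmodule (le_sInf hDΛ)).colon {x}, Submodule.span_mono ?_ hG1,
      fun d hd => Submodule.mem_colon_singleton.mp hd⟩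
    intro g hg
    obtain ⟨d, -, rfl⟩ := hG hg
    refine ⟨d, Submodule.mem_colon_singleton.mpr (Subring.mem_sInf.mpr fun B hB => ?_), rfl⟩
    exact hΛ hB _ (Finset.mem_image_of_mem _ hg)

theorem mem_saturation_sInf_of_isZariskiCompact {Λ : Set (Subring K)} (hc : IsZariskiCompact Λ)
    (hD : ∀ A ∈ Λ, D ≤ A) {x : K} (hx : ∀ A ∈ Λ, x ∈ saturation D T (A : Set K)) :
    x ∈ saturation D T (sInf Λ : Subring K) := by
  refine IsCompact.induction_on hc (p := fun Λ => x ∈ saturation D T (sInf Λ : Subring K))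
    ?_ (fun Λ₁ Λ₂ h => ?_) (fun Λ₁ Λ₂ h₁ h₂ => ?_) fun A hA => ?_
  · exact mem_saturation_of_forall_mul_mem T fun d => by simp
  · exact (saturation_mono (SetLike.coe_subset_coe.mpr (sInf_le_sInf h)) ·)
  · rw [sInf_union, Subring.coe_inf, saturation_inter]
    exact ⟨h₁, h₂⟩
  · obtain ⟨F, hAF, hF⟩ := exists_basicOpen_of_mem_saturation (hx A hA)
    exact ⟨Λ ∩ basicOpen F, inter_mem_nhdsWithin _ ((isOpen_basicOpen F).mem_nhds hAF),
      hF _ Set.inter_subset_right fun B hB => hD B hB.1⟩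

/-! ### Flat, independent and complete families -/

/-- Complete and independent families of flat overrings of `D`: what Jaffard and pre-Jaffard
families have in common. The spectra `σ(T)`, with the zero prime removed, partition the nonzero
primes of `D`. -/
structure IsFlatPartition (D : Subring K) (Θ : Set (Subring K)) : Prop where
  flat : ∀ T ∈ Θ, IsFlatOverring D T
  independent : IsIndependentFamily D Θ
  complete : IsCompleteFamily D Θ

theorem IsJaffardFamily.isFlatPartition {Θ : Set (Subring K)} (hΘ : IsJaffardFamily D Θ) :
    IsFlatPartition D Θ :=
  ⟨hΘ.flat, hΘ.independent, hΘ.complete⟩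

theorem IsPreJaffardFamily.isFlatPartition {Θ : Set (Subring K)} (hΘ : IsPreJaffardFamily D Θ) :
    IsFlatPartition D Θ :=
  ⟨hΘ.flat, hΘ.independent, hΘ.complete⟩

theorem image_subset_iInter_extension (Θ : Set (Subring K)) (I : Ideal D) :
    (fun x : D => (x : K)) '' (I : Set D) ⊆ ⋂ T ∈ Θ, (extension I T : Set K) :=
  Set.subset_iInter₂ fun _ _ => Submodule.subset_span

theorem IsCompleteFamily.of_forall_exists_le {Θ Θ' : Set (Subring K)}
    (hΘ : IsCompleteFamily D Θ) (h : ∀ T ∈ Θ, ∃ S ∈ Θ', S ≤ T) : IsCompleteFamily D Θ' := by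
  intro I
  refine subset_antisymm (image_subset_iInter_extension Θ' I) fun x hx => ?_
  rw [hΘ I]
  refine Set.mem_iInter₂.mpr fun T hT => ?_
  obtain ⟨S, hS, hST⟩ := h T hT
  exact extension_subset_of_le I hST (Set.mem_iInter₂.mp hx S hS)

theorem isCompleteFamily_of_forall_prime [IsFractionRing D K] {Θ : Set (Subring K)}
    (hflat : ∀ T ∈ Θ, IsFlatOverring D T)
    (hΘ : ∀ P : PrimeSpectrum D, ∃ T ∈ Θ, ∃ h : D ≤ T, P ∈ contractedPrimes h) :
    IsCompleteFamily D Θ := by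
  intro I
  refine subset_antisymm (image_subset_iInter_extension Θ I) fun x hx => ?_
  let M : Submodule D K := Submodule.map (Algebra.linearMap D K) I
  suffices M.colon {x} = ⊤ by
    have h1 := Submodule.mem_colon_singleton.mp ((Ideal.eq_top_iff_one _).mp this)
    rwa [one_smul] at h1
  by_contra hne
  obtain ⟨P, hP, hle⟩ := Ideal.exists_le_maximal _ hne
  obtain ⟨T, hT, hDT, hPT⟩ := hΘ ⟨P, hP.isPrime⟩
  have hxT := (hflat T hT).extension_subset_saturation le_rfl I (Set.mem_iInter₂.mp hx T hT)
  obtain ⟨d, hd, hdx⟩ := (mem_saturation_iff_forall_prime hDT M).mp hxT _ hPT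
  exact hd (hle (Submodule.mem_colon_singleton.mpr hdx))

theorem IsIndependentFamily.of_le [IsFractionRing D K] {Θ : Set (Subring K)}
    (hΘ : IsIndependentFamily D Θ) (hDR : D ≤ R) : IsIndependentFamily R Θ := by
  intro A hA B hB hAB hRA hRB
  have hinter := hΘ A hA B hB hAB (hDR.trans hRA) (hDR.trans hRB)
  rw [contractedPrimes_inter_eq_bot_iff] at hinter ⊢
  exact fun Q hQA hQB => eq_bot_of_comap_eq_bot hDR
    (hinter _ (comap_mem_contractedPrimes hDR hRA hQA) (comap_mem_contractedPrimes hDR hRB hQB))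

namespace IsFlatPartition

variable {Θ Θ' : Set (Subring K)}

theorem le_of_mem (hΘ : IsFlatPartition D Θ) (hT : T ∈ Θ) : D ≤ T :=
  (hΘ.flat T hT).1

theorem le_sInf_of_subset (hΘ : IsFlatPartition D Θ) (hsub : Θ' ⊆ Θ) : D ≤ sInf Θ' :=
  le_sInf fun _ hA => hΘ.le_of_mem (hsub hA)

theorem exists_mem_contractedPrimes (hΘ : IsFlatPartition D Θ) (P : PrimeSpectrum D) :
    ∃ T ∈ Θ, ∃ h : D ≤ T, P ∈ contractedPrimes h := by
  by_contra! hP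
  have h1 : (1 : K) ∈ (fun x : D => (x : K)) '' (P.asIdeal : Set D) := by
    rw [hΘ.complete]
    refine Set.mem_iInter₂.mpr fun T hT => ?_
    by_contra h1
    exact hP T hT _ ((hΘ.flat T hT).mem_contractedPrimes_iff.mpr h1)
  obtain ⟨d, hd, hd1⟩ := h1
  obtain rfl : d = 1 := Subtype.ext hd1
  exact P.2.ne_top ((Ideal.eq_top_iff_one _).mpr hd)

theorem saturation_eq_univ [IsFractionRing D K] (hΘ : IsFlatPartition D Θ) (hA : A ∈ Θ)
    (hT : T ∈ Θ) (hAT : A ≠ T) : saturation D T (A : Set K) = Set.univ :=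
  (hΘ.flat T hT).saturation_eq_univ (hΘ.le_of_mem hA) (hΘ.independent A hA T hT hAT _ _)

theorem saturation_sInf_eq_univ [IsFractionRing D K] (hΘ : IsFlatPartition D Θ) (hsub : Θ' ⊆ Θ)
    (hc : IsZariskiCompact Θ') (hT : T ∈ Θ) (hTΘ' : T ∉ Θ') :
    saturation D T (sInf Θ' : Subring K) = Set.univ := by
  refine Set.eq_univ_of_forall fun x => mem_saturation_sInf_of_isZariskiCompact hc
    (fun A hA => hΘ.le_of_mem (hsub hA)) fun A hA => ?_
  rw [hΘ.saturation_eq_univ (hsub hA) hT fun h => hTΘ' (h ▸ hA)]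
  exact Set.mem_univ x

end IsFlatPartition

/-- `Θ'` is a separated subfamily of `Θ` if the compositum of `⋂ Θ'` with each member of `Θ`
outside `Θ'` is `K`. -/
def IsSeparatedSubfamily (D : Subring K) (Θ Θ' : Set (Subring K)) : Prop :=
  Θ' ⊆ Θ ∧ ∀ T ∈ Θ \ Θ', saturation D T (sInf Θ' : Subring K) = Set.univ

theorem IsFlatPartition.isSeparatedSubfamily [IsFractionRing D K] {Θ Θ' : Set (Subring K)}
    (hΘ : IsFlatPartition D Θ) (hsub : Θ' ⊆ Θ) (hc : IsZariskiCompact Θ') :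
    IsSeparatedSubfamily D Θ Θ' :=
  ⟨hsub, fun _ hT => hΘ.saturation_sInf_eq_univ hsub hc hT.1 hT.2⟩

namespace IsSeparatedSubfamily

variable {Θ Θ' : Set (Subring K)}

theorem exists_mem_contractedPrimes (hsep : IsSeparatedSubfamily D Θ Θ')
    (hΘ : IsFlatPartition D Θ) (hS : D ≤ sInf Θ') {P : PrimeSpectrum D}
    (hP : P ∈ contractedPrimes hS) (hP0 : P ≠ ⊥) :
    ∃ T ∈ Θ', ∃ h : D ≤ T, P ∈ contractedPrimes h := by
  obtain ⟨T, hT, hDT, hPT⟩ := hΘ.exists_mem_contractedPrimes P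
  refine ⟨T, ?_, hDT, hPT⟩
  by_contra hTΘ'
  have hinter := contractedPrimes_inter_eq_bot_of_saturation_eq_univ hS hDT
    (hsep.2 T ⟨hT, hTΘ'⟩)
  exact hP0 ((contractedPrimes_inter_eq_bot_iff hS hDT).mp hinter P hP hPT)

theorem isFlatOverring_sInf [IsFractionRing D K] (hsep : IsSeparatedSubfamily D Θ Θ')
    (hΘ : IsFlatPartition D Θ) : IsFlatOverring D (sInf Θ') := by
  have hS := hΘ.le_sInf_of_subset hsep.1
  refine isFlatOverring_of_subset_saturation hS fun s hs => ?_
  refine (mem_saturation_iff_forall_prime hS (overringSubmodule le_rfl)).mpr fun P hP => ?_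
  by_cases hP0 : P = ⊥
  · obtain ⟨b, hb, hbs⟩ := exists_mul_mem D s
    exact ⟨b, hP0 ▸ hb, hbs⟩
  · obtain ⟨T, hT, hDT, hPT⟩ := hsep.exists_mem_contractedPrimes hΘ hS hP hP0
    have hsT := (hΘ.flat T (hsep.1 hT)).subset_saturation (Subring.mem_sInf.mp hs T hT)
    exact (mem_saturation_iff_forall_prime hDT (overringSubmodule le_rfl)).mp hsT P hPT

theorem isFlatPartition_sInf [IsFractionRing D K] (hsep : IsSeparatedSubfamily D Θ Θ')
    (hΘ : IsFlatPartition D Θ) (hne : Θ'.Nonempty) : IsFlatPartition (sInf Θ') Θ' := by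
  have hS := hΘ.le_sInf_of_subset hsep.1
  have := isFractionRing_of_le hS
  have hflat : ∀ T ∈ Θ', IsFlatOverring (sInf Θ') T := fun T hT =>
    (hΘ.flat T (hsep.1 hT)).of_le hS (sInf_le hT)
  have hind : IsIndependentFamily D Θ' := fun A hA B hB =>
    hΘ.independent A (hsep.1 hA) B (hsep.1 hB)
  refine ⟨hflat, hind.of_le hS, isCompleteFamily_of_forall_prime hflat fun Q => ?_⟩
  by_cases hQ : PrimeSpectrum.comap (Subring.inclusion hS) Q = ⊥
  · obtain ⟨T, hT⟩ := hne
    rw [eq_bot_of_comap_eq_bot hS hQ]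
    exact ⟨T, hT, sInf_le hT, bot_mem_contractedPrimes _⟩
  · obtain ⟨T, hT, _, hPT⟩ := hsep.exists_mem_contractedPrimes hΘ hS ⟨Q, rfl⟩ hQ
    exact ⟨T, hT, sInf_le hT,
      (hΘ.flat T (hsep.1 hT)).mem_contractedPrimes_of_comap hS (sInf_le hT) hPT⟩

end IsSeparatedSubfamily

theorem IsPreJaffardFamily.isPreJaffardFamily_sInf [IsFractionRing D K] {Θ Θ' : Set (Subring K)}
    (hΘ : IsPreJaffardFamily D Θ) (hsub : Θ' ⊆ Θ) (hc : IsZariskiCompact Θ')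
    (hne : Θ'.Nonempty) : IsPreJaffardFamily (sInf Θ') Θ' := by
  have hpart := (hΘ.isFlatPartition.isSeparatedSubfamily hsub hc).isFlatPartition_sInf
    hΘ.isFlatPartition hne
  refine ⟨fun T hT => sInf_le hT, ?_, hpart.flat, hpart.independent, hpart.complete, hc⟩
  refine hΘ.top_notMem_or.imp (fun htop h => htop (hsub h)) fun htop => ?_
  exact hne.subset_singleton_iff.mp (htop ▸ hsub)

/-! ### Jaffard overrings in a flat partition -/

theorem IsJaffardFamily.finite_setOf_inv_notMem {Θ : Set (Subring K)} (hΘ : IsJaffardFamily D Θ)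
    {a : D} (ha : a ≠ 0) : {A ∈ Θ | (a : K)⁻¹ ∉ A}.Finite := by
  have ha0 : (a : K) ≠ 0 := ZeroMemClass.coe_eq_zero.not.mpr ha
  refine (hΘ.locallyFinite a ha0).subset fun A hA =>
    ⟨hA.1, hΘ.overring A hA.1 a.2, fun hu => hA.2 ?_⟩
  obtain ⟨b, hb⟩ := hu.exists_right_inv
  rw [inv_eq_of_mul_eq_one_right (show (a : K) * b = 1 from congrArg Subtype.val hb)]
  exact b.2

theorem IsJaffardFamily.saturation_sInf_diff_singleton_eq_univ [IsFractionRing D K]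
    {Θ : Set (Subring K)} (hΘ : IsJaffardFamily D Θ) (hT : T ∈ Θ) :
    saturation D T (sInf (Θ \ {T}) : Subring K) = Set.univ := by
  refine Set.eq_univ_of_forall fun x => ?_
  obtain ⟨b, hb, hbx⟩ := exists_mul_mem D x
  let N : Set (Subring K) := {A ∈ Θ | (b : K)⁻¹ ∉ A} \ {T}
  have hN : N.Finite := (hΘ.finite_setOf_inv_notMem hb).subset Set.sdiff_subset
  obtain ⟨J, hJ, hJx⟩ : x ∈ saturation D T (sInf N : Subring K) := by
    rw [hΘ.isFlatPartition.saturation_sInf_eq_univ (fun A hA => hA.1.1) hN.isCompact hT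
      fun h => h.2 rfl]
    exact Set.mem_univ x
  refine ⟨J, hJ, fun d hd => Subring.mem_sInf.mpr fun A hA => ?_⟩
  have hDA := hΘ.overring A hA.1
  by_cases hbA : (b : K)⁻¹ ∈ A
  · exact mul_mem (hDA d.2) (mem_of_inv_mem hb hbx hDA hbA)
  · exact Subring.mem_sInf.mp (hJx d hd) A ⟨⟨hA.1, hbA⟩, hA.2⟩

namespace IsFlatPartition

variable {Θ Θ' : Set (Subring K)}

/-- The intersection of the other members depends only on `T`: the nonzero primes of `D` that
survive in them are those that do not survive in `T`. -/
theorem sInf_diff_singleton_le [IsFractionRing D K] (hΘ : IsFlatPartition D Θ)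
    (hΘ' : IsFlatPartition D Θ') (hT : T ∈ Θ) : sInf (Θ' \ {T}) ≤ sInf (Θ \ {T}) := by
  refine fun s hs => Subring.mem_sInf.mpr fun A hA => ?_
  have hDA := hΘ.le_of_mem hA.1
  refine saturation_subset_of_le (D := D) le_rfl
    (saturation_mono (SetLike.coe_subset_coe.mpr hDA) ?_)
  refine (mem_saturation_iff_forall_prime hDA (overringSubmodule le_rfl)).mpr fun P hP => ?_
  by_cases hP0 : P = ⊥
  · obtain ⟨b, hb, hbs⟩ := exists_mul_mem D s
    exact ⟨b, hP0 ▸ hb, hbs⟩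
  · obtain ⟨B, hB, hDB, hPB⟩ := hΘ'.exists_mem_contractedPrimes P
    have hBT : B ≠ T := by
      rintro rfl
      exact hP0 ((contractedPrimes_inter_eq_bot_iff hDA hDB).mp
        (hΘ.independent A hA.1 B hT hA.2 hDA hDB) P hP hPB)
    have hsB := (hΘ'.flat B hB).subset_saturation (Subring.mem_sInf.mp hs B ⟨hB, hBT⟩)
    exact (mem_saturation_iff_forall_prime hDB (overringSubmodule le_rfl)).mp hsB P hPB

theorem isSeparatedSubfamily_diff_singleton [IsFractionRing D K] (hΘ : IsFlatPartition D Θ)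
    (hT : T ∈ jaffardPart D Θ) : IsSeparatedSubfamily D Θ (Θ \ {T}) := by
  refine ⟨Set.sdiff_subset, fun A hA => ?_⟩
  obtain rfl : A = T := by
    by_contra hne
    exact hA.2 ⟨hA.1, hne⟩
  obtain ⟨Θ', hΘ', hAΘ'⟩ := hT.2
  refine Set.univ_subset_iff.mp ((hΘ'.saturation_sInf_diff_singleton_eq_univ hAΘ').symm.subset.trans
    (saturation_mono (SetLike.coe_subset_coe.mpr ?_)))
  exact hΘ.sInf_diff_singleton_le hΘ'.isFlatPartition hT.1

/-- For `x = a⁻¹`, with `a` nonzero in `D`, this isolates `T` among the members of `Θ` in which `a`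
is not a unit. -/
theorem exists_basicOpen_of_mem_jaffardPart [IsFractionRing D K] (hΘ : IsFlatPartition D Θ)
    (hT : T ∈ jaffardPart D Θ) (x : K) :
    ∃ F : Finset K, T ∈ basicOpen F ∧ ∀ A ∈ Θ, A ≠ T → A ∈ basicOpen F → x ∈ A := by
  have hsep := hΘ.isSeparatedSubfamily_diff_singleton hT
  have hflat := hsep.isFlatOverring_sInf hΘ
  have hDT := hΘ.le_of_mem hT.1
  have hinter := contractedPrimes_inter_eq_bot_of_saturation_eq_univ hflat.1 hDT
    (hsep.2 T ⟨hT.1, fun h => h.2 rfl⟩)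
  rw [Set.inter_comm] at hinter
  obtain ⟨F, hTF, hF⟩ := exists_basicOpen_of_mem_saturation
    ((hflat.saturation_eq_univ hDT hinter).ge (Set.mem_univ x))
  refine ⟨F, hTF, fun A hA hAT hAF => ?_⟩
  have hxA := hF {A} (Set.singleton_subset_iff.mpr hAF) fun B hB =>
    Set.mem_singleton_iff.mp hB ▸ hΘ.le_of_mem hA
  rw [sInf_singleton] at hxA
  exact saturation_subset_of_le (sInf_le (show A ∈ Θ \ {T} from ⟨hA, hAT⟩)) hxA

end IsFlatPartition

/-! ### The derived sequence -/

/-- For every nonzero `a` in `D`, the set `Θ'` is closed in `Θ` when both are restricted to the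
rings in which `a` is not a unit. Unlike compactness, this passes to arbitrary intersections. -/
def IsClosedOnNonunitLoci (D : Subring K) (Θ Θ' : Set (Subring K)) : Prop :=
  ∀ a : D, a ≠ 0 → ∃ C : Set (Subring K), IsClosed C ∧
    ∀ A ∈ Θ, (a : K)⁻¹ ∉ A → (A ∈ Θ' ↔ A ∈ C)

namespace IsClosedOnNonunitLoci

variable {Θ Θ' : Set (Subring K)}

theorem refl (D : Subring K) (Θ : Set (Subring K)) : IsClosedOnNonunitLoci D Θ Θ :=
  fun _ _ => ⟨Set.univ, isClosed_univ, fun A hA _ => iff_of_true hA (Set.mem_univ A)⟩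

theorem iInter {ι : Sort*} {Θ' : ι → Set (Subring K)}
    (h : ∀ i, IsClosedOnNonunitLoci D Θ (Θ' i)) : IsClosedOnNonunitLoci D Θ (⋂ i, Θ' i) := by
  intro a ha
  choose C hC hΘC using fun i => h i a ha
  refine ⟨⋂ i, C i, isClosed_iInter hC, fun A hA haA => ?_⟩
  simp only [Set.mem_iInter, hΘC _ A hA haA]

theorem diff_jaffardPart [IsFractionRing R K] (h : IsClosedOnNonunitLoci D Θ Θ')
    (hΘ' : IsFlatPartition R Θ') : IsClosedOnNonunitLoci D Θ (Θ' \ jaffardPart R Θ') := by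
  intro a ha
  obtain ⟨C, hC, hΘC⟩ := h a ha
  choose F hTF hF using fun T : jaffardPart R Θ' =>
    hΘ'.exists_basicOpen_of_mem_jaffardPart T.2 (a : K)⁻¹
  have hJ : ∀ A ∈ Θ', (a : K)⁻¹ ∉ A → (A ∈ jaffardPart R Θ' ↔ A ∈ ⋃ T, basicOpen (F T)) := by
    refine fun A hA haA => ⟨fun hAJ => Set.mem_iUnion.mpr ⟨⟨A, hAJ⟩, hTF _⟩, fun hAF => ?_⟩
    obtain ⟨T, hAT⟩ := Set.mem_iUnion.mp hAF
    by_contra hAJ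
    exact haA (hF T A hA (fun hEq => hAJ (hEq ▸ T.2)) hAT)
  refine ⟨C \ ⋃ T, basicOpen (F T), hC.sdiff (isOpen_iUnion fun T => isOpen_basicOpen _),
    fun A hA haA => ?_⟩
  rw [Set.mem_sdiff, Set.mem_sdiff, ← hΘC A hA haA]
  exact and_congr_right fun hAΘ' => (hJ A hAΘ' haA).not

theorem isZariskiCompact [IsFractionRing D K] (h : IsClosedOnNonunitLoci D Θ Θ')
    (hsub : Θ' ⊆ Θ) (hD : ∀ A ∈ Θ, D ≤ A) (hc : IsZariskiCompact Θ) : IsZariskiCompact Θ' := by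
  refine isZariskiCompact_of_forall_inv_notMem (fun A hA => hD A (hsub hA)) fun a ha => ?_
  obtain ⟨C, hC, hΘC⟩ := h a ha
  have hEq : Θ' ∩ {A | (a : K)⁻¹ ∉ A} = Θ ∩ (C ∩ {A | (a : K)⁻¹ ∉ A}) := by
    ext A
    exact ⟨fun hA => ⟨hsub hA.1, (hΘC A (hsub hA.1) hA.2).mp hA.1, hA.2⟩,
      fun hA => ⟨(hΘC A hA.1 hA.2.2).mpr hA.2.1, hA.2.2⟩⟩
  rw [hEq]
  exact IsCompact.inter_right hc (hC.inter (isClosed_setOf_notMem _))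

end IsClosedOnNonunitLoci

namespace IsPreJaffardFamily

variable {Θ : Set (Subring K)}

theorem isZariskiCompact_diff_jaffardPart [IsFractionRing D K] (hΘ : IsPreJaffardFamily D Θ) :
    IsZariskiCompact (Θ \ jaffardPart D Θ) :=
  ((IsClosedOnNonunitLoci.refl D Θ).diff_jaffardPart hΘ.isFlatPartition).isZariskiCompact
    Set.sdiff_subset hΘ.overring hΘ.compact

theorem top_notMem_or_jaffardPart_union (hΘ : IsPreJaffardFamily D Θ)
    (hne : (Θ \ jaffardPart D Θ).Nonempty) :
    ⊤ ∉ jaffardPart D Θ ∪ {sInf (Θ \ jaffardPart D Θ)} ∨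
      jaffardPart D Θ ∪ {sInf (Θ \ jaffardPart D Θ)} = {⊤} := by
  obtain ⟨A, hA⟩ := hne
  refine hΘ.top_notMem_or.imp (fun htop => ?_) fun htop => ?_
  · rintro (h | h)
    · exact htop h.1
    · rw [Set.mem_singleton_iff] at h
      exact htop (top_le_iff.mp (h.trans_le (sInf_le hA)) ▸ hA.1)
  · have hall : ∀ T ∈ Θ, T = ⊤ := fun T hT => Set.mem_singleton_iff.mp (htop ▸ hT)
    have hJ : jaffardPart D Θ = ∅ := Set.eq_empty_of_forall_notMem fun T hT =>
      hA.2 ((hall T hT.1).trans (hall A hA.1).symm ▸ hT)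
    rw [hJ, Set.empty_union, Set.sdiff_empty, htop, sInf_singleton]

theorem isWeakJaffardFamily [IsFractionRing D K] (hΘ : IsPreJaffardFamily D Θ)
    (hne : (Θ \ jaffardPart D Θ).Nonempty) :
    IsWeakJaffardFamily D (jaffardPart D Θ ∪ {sInf (Θ \ jaffardPart D Θ)})
      (sInf (Θ \ jaffardPart D Θ)) := by
  have hpart := hΘ.isFlatPartition
  have hsep := hpart.isSeparatedSubfamily Set.sdiff_subset hΘ.isZariskiCompact_diff_jaffardPart
  have hflat := hsep.isFlatOverring_sInf hpart
  set S := sInf (Θ \ jaffardPart D Θ)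
  refine ⟨?_, Or.inr rfl, ?_, ?_, ?_, ?_, hflat⟩
  · rintro T (hT | rfl)
    exacts [hΘ.overring T hT.1, hflat.1]
  · exact hΘ.top_notMem_or_jaffardPart_union hne
  · refine hΘ.complete.of_forall_exists_le fun T hT => ?_
    by_cases hTJ : T ∈ jaffardPart D Θ
    · exact ⟨T, Or.inl hTJ, le_rfl⟩
    · exact ⟨S, Or.inr rfl, sInf_le ⟨hT, hTJ⟩⟩
  · have hS : ∀ A ∈ jaffardPart D Θ, ∀ (hA : D ≤ A),
        contractedPrimes hflat.1 ∩ contractedPrimes hA = {⊥} := fun A hA hDA =>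
      contractedPrimes_inter_eq_bot_of_saturation_eq_univ hflat.1 hDA
        (hsep.2 A ⟨hA.1, fun h => h.2 hA⟩)
    rintro A (hA | rfl) B (hB | rfl) hAB hDA hDB
    · exact hΘ.independent A hA.1 B hB.1 hAB hDA hDB
    · exact Set.inter_comm _ _ ▸ hS A hA hDA
    · exact hS B hB hDB
    · exact absurd rfl hAB
  · rintro T ⟨hT | hT, hTS⟩
    · exact hT.2
    · exact absurd hT hTS

end IsPreJaffardFamily

theorem derivedFamily_subset (D : Subring K) (Θ : Set (Subring K)) (α : Ordinal.{v}) :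
    derivedFamily D Θ α ⊆ Θ := by
  induction α using Ordinal.limitRecOn with
  | zero => rw [derivedFamily_zero]
  | add_one γ ih =>
    rw [derivedFamily_add_one]
    exact Set.sdiff_subset.trans ih
  | limit α hα ih =>
    rw [derivedFamily_limit D Θ hα]
    exact fun T hT => ih ⊥ hα.bot_lt (Set.mem_iInter₂.mp hT ⊥ hα.bot_lt)

theorem le_derivedRing {Θ : Set (Subring K)} (hΘ : ∀ T ∈ Θ, D ≤ T) (α : Ordinal.{v}) :
    D ≤ derivedRing D Θ α := by
  by_cases hα : α = 0
  · rw [hα, derivedRing_zero]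
  · rw [derivedRing_of_ne_zero D Θ hα]
    exact le_sInf fun T hT => hΘ T (derivedFamily_subset D Θ α hT)

namespace IsPreJaffardFamily

variable {Θ : Set (Subring K)}

theorem derived_of_isClosedOnNonunitLoci [IsFractionRing D K] (hΘ : IsPreJaffardFamily D Θ)
    {α : Ordinal.{v}} (hcl : IsClosedOnNonunitLoci D Θ (derivedFamily D Θ α))
    (hne : (derivedFamily D Θ α).Nonempty) :
    IsPreJaffardFamily (derivedRing D Θ α) (derivedFamily D Θ α) := by
  by_cases hα : α = 0
  · rwa [hα, derivedRing_zero, derivedFamily_zero]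
  · have hsub := derivedFamily_subset D Θ α
    rw [derivedRing_of_ne_zero D Θ hα]
    exact hΘ.isPreJaffardFamily_sInf hsub
      (hcl.isZariskiCompact hsub hΘ.overring hΘ.compact) hne

theorem isClosedOnNonunitLoci_derivedFamily [IsFractionRing D K] (hΘ : IsPreJaffardFamily D Θ)
    (α : Ordinal.{v}) : IsClosedOnNonunitLoci D Θ (derivedFamily D Θ α) := by
  induction α using Ordinal.limitRecOn with
  | zero =>
    rw [derivedFamily_zero]
    exact .refl D Θ
  | add_one γ ih =>
    rw [derivedFamily_add_one]
    rcases (derivedFamily D Θ γ).eq_empty_or_nonempty with hempty | hne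
    · rw [hempty] at ih ⊢
      rwa [Set.empty_sdiff]
    · have := isFractionRing_of_le (le_derivedRing hΘ.overring γ)
      exact ih.diff_jaffardPart (hΘ.derived_of_isClosedOnNonunitLoci ih hne).isFlatPartition
  | limit α hα ih =>
    rw [derivedFamily_limit D Θ hα]
    exact .iInter fun β => .iInter fun hβ => ih β hβ

theorem derived [IsFractionRing D K] (hΘ : IsPreJaffardFamily D Θ) {α : Ordinal.{v}}
    (hne : (derivedFamily D Θ α).Nonempty) :
    IsPreJaffardFamily (derivedRing D Θ α) (derivedFamily D Θ α) :=
  hΘ.derived_of_isClosedOnNonunitLoci (hΘ.isClosedOnNonunitLoci_derivedFamily α) hne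

end IsPreJaffardFamily

end JaffardFamilies

theorem mainTheorem8 {K : Type u} [Field K] (D : Subring K) [IsFractionRing D K]
    (Θ : Set (Subring K)) (hΘ : IsPreJaffardFamily D Θ) :
    (∀ α : Ordinal.{v}, (derivedFamily D Θ α).Nonempty →
      IsPreJaffardFamily (derivedRing D Θ α) (derivedFamily D Θ α)) ∧
    (∀ α γ : Ordinal.{v}, α = γ + 1 → (derivedFamily D Θ α).Nonempty →
      IsWeakJaffardFamily (derivedRing D Θ γ)
        (jaffardPart (derivedRing D Θ γ) (derivedFamily D Θ γ) ∪ {derivedRing D Θ α})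
        (derivedRing D Θ α)) := by
  refine ⟨fun α => hΘ.derived, ?_⟩
  rintro _ γ rfl hne
  rw [derivedRing_of_ne_zero D Θ (show γ + 1 ≠ 0 from Order.succ_ne_bot γ)]
  rw [derivedFamily_add_one] at hne ⊢
  have := isFractionRing_of_le (le_derivedRing hΘ.overring γ)
  exact (hΘ.derived (hne.mono Set.sdiff_subset)).isWeakJaffardFamily hne
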